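/- Rings are associative and unital, and modules are right modules. Let $\Gamma$ be an (additive) abelian group and let $R=\bigoplus_{\gamma\in\Gamma}R_\gamma$ be a ring graded over $\Gamma$, i.e. $R_\gamma R_{\gamma'}\subseteq R_{\gamma+\gamma'}$ for all $\gamma,\gamma'\in\Gamma$. Let $\mathrm{Mod}\,R$ be the category of $R$-modules, and let $\mathrm{GrMod}\,R$ be the abelian category whose objects are the graded $R$-modules, that is, the $R$-modules $M$ with a decomposition $M=\bigoplus_{\gamma\in\Gamma}M_\gamma$ into additive subgroups such that $M_\gamma R_{\gamma'}\subseteq M_{\gamma+\gamma'}$ for all $\gamma,\gamma'\in\Gamma$, and whose morphisms are the $R$-module homomorphisms $f\colon M\to N$ with $f(M_\gamma)\subseteq N_\gamma$ for all $\gamma\in\Gamma$. Write $\mathrm{Inj}\,R$ and $\mathrm{GrInj}\,R$ for the classes of injective objects of $\mathrm{Mod}\,R$ and $\mathrm{GrMod}\,R$, regarded as complexes concentrated in degree $0$ in the unbounded derived categories $\mathsf D(\mathrm{Mod}\,R)$ and $\mathsf D(\mathrm{GrMod}\,R)$. For a class $S$ of objects of a triangulated category $\mathcal T$ with set-indexed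 coproducts, let $\mathsf{Loc}_{\mathcal T}(S)$ be the smallest localizing subcategory of $\mathcal T$ (triangulated subcategory closed under isomorphisms and set-indexed coproducts) that contains $S$. If injectives generate for $R$, i.e. $\mathsf{Loc}(\mathrm{Inj}\,R)=\mathsf D(\mathrm{Mod}\,R)$, then graded injectives generate for $R$, i.e. $\mathsf{Loc}(\mathrm{GrInj}\,R)=\mathsf D(\mathrm{GrMod}\,R)$. -/

import Mathlib

open CategoryTheory Limits

universe w w' u v

/-! ## Graded right modules -/

/-- A graded right module over a ring `R` graded by the family `𝒜`: a right `R`-module `M` (that is,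
a module over `Rᵐᵒᵖ`) together with a decomposition `M = ⨁ γ, M_γ` into additive subgroups such that
`M_γ · R_γ' ⊆ M_(γ + γ')`. -/
structure GrModCat {Γ : Type v} [AddCommGroup Γ] [DecidableEq Γ] {R : Type u} [Ring R]
    (𝒜 : Γ → AddSubgroup R) where
  carrier : Type w
  [addCommGroup : AddCommGroup carrier]
  [module : Module Rᵐᵒᵖ carrier]
  grading : Γ → AddSubgroup carrier
  isInternal : DirectSum.IsInternal grading
  smul_mem : ∀ {γ γ' : Γ} {m : carrier} {r : R}, m ∈ grading γ → r ∈ 𝒜 γ' →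
    MulOpposite.op r • m ∈ grading (γ + γ')

namespace GrModCat

attribute [instance] GrModCat.addCommGroup GrModCat.module

variable {Γ : Type v} [AddCommGroup Γ] [DecidableEq Γ] {R : Type u} [Ring R]
  {𝒜 : Γ → AddSubgroup R}

/-- A homomorphism of graded right modules: a module homomorphism `f : M → N` with
`f(M_γ) ⊆ N_γ` for all `γ`. -/
@[ext]
structure Hom (M N : GrModCat.{w} 𝒜) where
  toLin : M.carrier →ₗ[Rᵐᵒᵖ] N.carrier
  map_mem : ∀ (γ : Γ) (m : M.carrier), m ∈ M.grading γ → toLin m ∈ N.grading γ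

/-- The category of graded right modules. -/
instance : Category.{w} (GrModCat.{w} 𝒜) where
  Hom M N := Hom M N
  id M := ⟨LinearMap.id, fun _ _ h => h⟩
  comp f g := ⟨g.toLin ∘ₗ f.toLin, fun γ m h => g.map_mem γ _ (f.map_mem γ m h)⟩

/-- The underlying module homomorphism of a morphism of graded modules. -/
def lin {M N : GrModCat.{w} 𝒜} (f : M ⟶ N) : M.carrier →ₗ[Rᵐᵒᵖ] N.carrier := Hom.toLin f

/-- Build a morphism of graded modules from a degree preserving module homomorphism. -/
def ofLin {M N : GrModCat.{w} 𝒜} (f : M.carrier →ₗ[Rᵐᵒᵖ] N.carrier)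
    (hf : ∀ (γ : Γ) (m : M.carrier), m ∈ M.grading γ → f m ∈ N.grading γ) : M ⟶ N :=
  Hom.mk f hf

lemma lin_mem {M N : GrModCat.{w} 𝒜} (f : M ⟶ N) {γ : Γ} {m : M.carrier}
    (h : m ∈ M.grading γ) : lin f m ∈ N.grading γ := Hom.map_mem f γ m h

lemma hom_ext {M N : GrModCat.{w} 𝒜} {f g : M ⟶ N} (h : ∀ m, lin f m = lin g m) : f = g :=
  Hom.ext (LinearMap.ext h)

@[simp] lemma lin_ofLin {M N : GrModCat.{w} 𝒜} (f : M.carrier →ₗ[Rᵐᵒᵖ] N.carrier) (hf) :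
    lin (ofLin (M := M) (N := N) f hf) = f := rfl

@[simp] lemma lin_comp {M N P : GrModCat.{w} 𝒜} (f : M ⟶ N) (g : N ⟶ P) (m : M.carrier) :
    lin (f ≫ g) m = lin g (lin f m) := rfl

@[simp] lemma lin_id {M : GrModCat.{w} 𝒜} (m : M.carrier) : lin (𝟙 M) m = m := rfl

/-! ### The additive structure -/

instance {M N : GrModCat.{w} 𝒜} : Zero (M ⟶ N) :=
  ⟨ofLin 0 fun γ _ _ => (N.grading γ).zero_mem⟩

instance {M N : GrModCat.{w} 𝒜} : Add (M ⟶ N) :=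
  ⟨fun f g => ofLin (lin f + lin g) fun γ _ h => (N.grading γ).add_mem (lin_mem f h) (lin_mem g h)⟩

instance {M N : GrModCat.{w} 𝒜} : Neg (M ⟶ N) :=
  ⟨fun f => ofLin (-lin f) fun γ _ h => (N.grading γ).neg_mem (lin_mem f h)⟩

@[simp] lemma lin_zero {M N : GrModCat.{w} 𝒜} (m : M.carrier) :
    lin (0 : M ⟶ N) m = 0 := rfl

@[simp] lemma lin_add {M N : GrModCat.{w} 𝒜} (f g : M ⟶ N) (m : M.carrier) :
    lin (f + g) m = lin f m + lin g m := rfl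

@[simp] lemma lin_neg {M N : GrModCat.{w} 𝒜} (f : M ⟶ N) (m : M.carrier) :
    lin (-f) m = -lin f m := rfl

instance {M N : GrModCat.{w} 𝒜} : AddCommGroup (M ⟶ N) where
  add_assoc f g h := hom_ext fun m => by simp [add_assoc]
  zero_add f := hom_ext fun m => by simp
  add_zero f := hom_ext fun m => by simp
  add_comm f g := hom_ext fun m => by simp [add_comm]
  neg_add_cancel f := hom_ext fun m => by simp
  nsmul := nsmulRec
  zsmul := zsmulRec

instance : Preadditive (GrModCat.{w} 𝒜) where
  add_comp _ _ _ f g h := hom_ext fun m => by simp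
  comp_add _ _ _ f g h := hom_ext fun m => by simp

/-! ### Homogeneous components -/

/-- A family of additive subgroups is a direct sum decomposition as soon as there is a family of
additive projections onto it for which every element is a finite sum of its projections. -/
lemma isInternal_of_proj {M : Type*} [AddCommGroup M] (ℳ : Γ → AddSubgroup M)
    (p : Γ → M →+ M) (hp : ∀ γ m, p γ m ∈ ℳ γ) (hsame : ∀ γ, ∀ m ∈ ℳ γ, p γ m = m)
    (hne : ∀ γ γ', γ ≠ γ' → ∀ m ∈ ℳ γ, p γ' m = 0)
    (hsum : ∀ m, ∃ s : Finset Γ, m = ∑ γ ∈ s, p γ m) : DirectSum.IsInternal ℳ := by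
  have key : ∀ (x : DirectSum Γ fun γ => ℳ γ) (γ : Γ),
      p γ (DirectSum.coeAddMonoidHom ℳ x) = x γ := by
    intro x γ
    induction x using DirectSum.induction_on with
    | zero => simp
    | of i y =>
      rw [DirectSum.coeAddMonoidHom_of]
      by_cases h : i = γ
      · subst h
        rw [DirectSum.of_eq_same]
        exact hsame _ _ y.2
      · rw [DirectSum.of_eq_of_ne _ _ _ (Ne.symm h)]
        exact hne _ _ h _ y.2
    | add x y hx hy => simp [hx, hy]
  refine ⟨fun x y hxy => ?_, fun m => ?_⟩
  · refine DFinsupp.ext fun γ => Subtype.ext ?_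
    rw [← key x γ, ← key y γ, hxy]
  · obtain ⟨s, hs⟩ := hsum m
    refine ⟨∑ γ ∈ s, DirectSum.of (fun γ => ℳ γ) γ ⟨p γ m, hp γ m⟩, ?_⟩
    rw [map_sum]
    simp only [DirectSum.coeAddMonoidHom_of]
    exact hs.symm

/-- The projection of a graded module onto its component of degree `γ`. -/
noncomputable def proj (M : GrModCat.{w} 𝒜) (γ : Γ) : M.carrier →+ M.carrier :=
  letI := M.isInternal.chooseDecomposition
  { toFun := fun m => (DirectSum.decompose M.grading m γ : M.carrier)
    map_zero' := by simp
    map_add' := fun x y => by simp }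

lemma proj_mem (M : GrModCat.{w} 𝒜) (γ : Γ) (m : M.carrier) : M.proj γ m ∈ M.grading γ :=
  Subtype.prop _

lemma proj_same (M : GrModCat.{w} 𝒜) {γ : Γ} {m : M.carrier} (h : m ∈ M.grading γ) :
    M.proj γ m = m :=
  letI := M.isInternal.chooseDecomposition
  DirectSum.decompose_of_mem_same M.grading h

lemma proj_ne (M : GrModCat.{w} 𝒜) {γ γ' : Γ} (hne : γ ≠ γ') {m : M.carrier}
    (h : m ∈ M.grading γ) : M.proj γ' m = 0 :=
  letI := M.isInternal.chooseDecomposition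
  DirectSum.decompose_of_mem_ne M.grading h hne

lemma sum_proj (M : GrModCat.{w} 𝒜) (m : M.carrier) :
    ∃ s : Finset Γ, ∀ t, s ⊆ t → m = ∑ γ ∈ t, M.proj γ m := by
  classical
  letI := M.isInternal.chooseDecomposition
  refine ⟨(DirectSum.decompose M.grading m).support, fun t ht => ?_⟩
  conv_lhs => rw [← DirectSum.sum_support_decompose M.grading m]
  refine Finset.sum_subset ht fun γ _ hγ => ?_
  simpa using hγ

lemma lin_proj {M N : GrModCat.{w} 𝒜} (f : M ⟶ N) (γ : Γ) (m : M.carrier) :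
    lin f (M.proj γ m) = N.proj γ (lin f m) := by
  obtain ⟨s, hs⟩ := M.sum_proj m
  have h := hs (insert γ s) (Finset.subset_insert _ _)
  conv_rhs => rw [h]
  rw [map_sum, map_sum, Finset.sum_eq_single γ]
  · exact (N.proj_same (lin_mem f (M.proj_mem γ m))).symm
  · intro γ' _ hne
    exact N.proj_ne hne (lin_mem f (M.proj_mem γ' m))
  · intro h'
    exact absurd (Finset.mem_insert_self γ s) h'

/-! ### Kernels -/

/-- The kernel of a morphism of graded modules, with the induced grading. -/
noncomputable def ker {M N : GrModCat.{w} 𝒜} (f : M ⟶ N) : GrModCat.{w} 𝒜 where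
  carrier := LinearMap.ker (lin f)
  grading γ := (M.grading γ).comap (LinearMap.ker (lin f)).subtype.toAddMonoidHom
  isInternal := by
    refine isInternal_of_proj _
      (fun γ => ((M.proj γ).comp (LinearMap.ker (lin f)).subtype.toAddMonoidHom).codRestrict
        (LinearMap.ker (lin f)) fun x => ?_) ?_ ?_ ?_ ?_
    · have : lin f x.1 = 0 := x.2
      change lin f (M.proj γ x.1) = 0
      rw [lin_proj, this, map_zero]
    · exact fun γ m => M.proj_mem γ m.1
    · exact fun γ m h => Subtype.ext (M.proj_same h)
    · exact fun γ γ' hne m h => Subtype.ext (M.proj_ne hne h)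
    · intro m
      obtain ⟨s, hs⟩ := M.sum_proj m.1
      refine ⟨s, Subtype.ext ?_⟩
      rw [AddSubmonoidClass.coe_finsetSum]
      exact hs s subset_rfl
  smul_mem hm hr := M.smul_mem hm hr

/-- The inclusion of the kernel. -/
noncomputable def kerι {M N : GrModCat.{w} 𝒜} (f : M ⟶ N) : ker f ⟶ M :=
  ofLin (LinearMap.ker (lin f)).subtype fun _ _ h => h

lemma kerι_comp {M N : GrModCat.{w} 𝒜} (f : M ⟶ N) : kerι f ≫ f = 0 :=
  hom_ext fun m => m.2

/-- The kernel satisfies the universal property of the kernel. -/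
noncomputable def kerIsLimit {M N : GrModCat.{w} 𝒜} (f : M ⟶ N) :
    IsLimit (KernelFork.ofι (kerι f) (kerι_comp f)) :=
  KernelFork.IsLimit.ofι _ _
    (fun g hg => ofLin (N := ker f)
      ((lin g).codRestrict (LinearMap.ker (lin f)) fun m => congrArg (fun k => lin k m) hg)
      fun _ _ h => lin_mem g h)
    (fun _ _ => rfl)
    (fun _ _ _ hm => hom_ext fun x => Subtype.ext (congrArg (fun k => lin k x) hm))

instance : HasKernels (GrModCat.{w} 𝒜) where
  has_limit f := ⟨⟨_, kerIsLimit f⟩⟩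

/-! ### Cokernels -/

/-- The cokernel of a morphism of graded modules, with the induced grading. -/
noncomputable def coker {M N : GrModCat.{w} 𝒜} (f : M ⟶ N) : GrModCat.{w} 𝒜 where
  carrier := N.carrier ⧸ LinearMap.range (lin f)
  grading γ := (N.grading γ).map (LinearMap.range (lin f)).mkQ.toAddMonoidHom
  isInternal := by
    let p : Γ → (N.carrier ⧸ LinearMap.range (lin f)) →+ (N.carrier ⧸ LinearMap.range (lin f)) :=
      fun γ => QuotientAddGroup.map (LinearMap.range (lin f)).toAddSubgroup
        (LinearMap.range (lin f)).toAddSubgroup (N.proj γ) (by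
          rintro _ ⟨m, rfl⟩
          exact ⟨M.proj γ m, lin_proj f γ m⟩)
    have hp : ∀ γ n, p γ ((LinearMap.range (lin f)).mkQ n) =
      (LinearMap.range (lin f)).mkQ (N.proj γ n) := fun _ _ => rfl
    refine isInternal_of_proj _ p ?_ ?_ ?_ ?_
    · intro γ m
      obtain ⟨n, rfl⟩ := (LinearMap.range (lin f)).mkQ_surjective m
      exact ⟨_, N.proj_mem γ n, rfl⟩
    · rintro γ _ ⟨n, hn, rfl⟩
      exact (hp γ n).trans (by rw [N.proj_same hn]; rfl)
    · rintro γ γ' hne _ ⟨n, hn, rfl⟩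
      exact (hp γ' n).trans (by rw [N.proj_ne hne hn, map_zero])
    · intro m
      obtain ⟨n, rfl⟩ := (LinearMap.range (lin f)).mkQ_surjective m
      obtain ⟨s, hs⟩ := N.sum_proj n
      refine ⟨s, ?_⟩
      simp only [hp]
      rw [← map_sum, ← hs s subset_rfl]
  smul_mem := by
    rintro γ γ' _ r ⟨n, hn, rfl⟩ hr
    exact ⟨_, N.smul_mem hn hr, rfl⟩

/-- The projection to the cokernel. -/
noncomputable def cokerπ {M N : GrModCat.{w} 𝒜} (f : M ⟶ N) : N ⟶ coker f :=
  ofLin (N := coker f) (LinearMap.range (lin f)).mkQ fun _ n h => ⟨n, h, rfl⟩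

lemma comp_cokerπ {M N : GrModCat.{w} 𝒜} (f : M ⟶ N) : f ≫ cokerπ f = 0 :=
  hom_ext fun m => (Submodule.Quotient.mk_eq_zero _).2 ⟨m, rfl⟩

/-- The cokernel satisfies the universal property of the cokernel. -/
noncomputable def cokerIsColimit {M N : GrModCat.{w} 𝒜} (f : M ⟶ N) :
    IsColimit (CokernelCofork.ofπ (cokerπ f) (comp_cokerπ f)) :=
  CokernelCofork.IsColimit.ofπ _ _
    (fun g hg => ofLin (M := coker f)
      ((LinearMap.range (lin f)).liftQ (lin g) (by
        rintro _ ⟨m, rfl⟩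
        exact congrArg (fun k => lin k m) hg))
      (by
        rintro γ _ ⟨n, hn, rfl⟩
        exact lin_mem g hn))
    (fun _ _ => rfl)
    (fun _ _ _ hm => hom_ext fun x => by
      obtain ⟨n, rfl⟩ := (LinearMap.range (lin f)).mkQ_surjective x
      exact congrArg (fun k => lin k n) hm)

instance : HasCokernels (GrModCat.{w} 𝒜) where
  has_colimit f := ⟨⟨_, cokerIsColimit f⟩⟩

/-! ### Finite products -/

/-- The zero graded module. -/
def zeroObj : GrModCat.{w} 𝒜 where
  carrier := PUnit
  grading _ := ⊤
  isInternal := isInternal_of_proj _ (fun _ => 0) (fun _ _ => trivial) (fun _ _ _ => rfl)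
    (fun _ _ _ _ _ => rfl) (fun _ => ⟨∅, rfl⟩)
  smul_mem _ _ := trivial

instance : HasZeroObject (GrModCat.{w} 𝒜) where
  zero := ⟨zeroObj, (IsZero.iff_id_eq_zero _).2 (hom_ext fun _ => rfl)⟩

/-- The direct sum of two graded modules. -/
noncomputable def prod (M N : GrModCat.{w} 𝒜) : GrModCat.{w} 𝒜 where
  carrier := M.carrier × N.carrier
  grading γ := (M.grading γ).prod (N.grading γ)
  isInternal := by
    refine isInternal_of_proj _ (fun γ => (M.proj γ).prodMap (N.proj γ)) ?_ ?_ ?_ ?_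
    · exact fun γ m => ⟨M.proj_mem γ m.1, N.proj_mem γ m.2⟩
    · exact fun γ m h => Prod.ext (M.proj_same h.1) (N.proj_same h.2)
    · exact fun γ γ' hne m h => Prod.ext (M.proj_ne hne h.1) (N.proj_ne hne h.2)
    · intro m
      obtain ⟨s, hs⟩ := M.sum_proj m.1
      obtain ⟨t, ht⟩ := N.sum_proj m.2
      refine ⟨s ∪ t, Prod.ext ?_ ?_⟩
      · rw [Prod.fst_sum]
        exact hs _ Finset.subset_union_left
      · rw [Prod.snd_sum]
        exact ht _ Finset.subset_union_right
  smul_mem hm hr := ⟨M.smul_mem hm.1 hr, N.smul_mem hm.2 hr⟩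

instance : HasBinaryProducts (GrModCat.{w} 𝒜) :=
  haveI (M N : GrModCat.{w} 𝒜) : HasLimit (pair M N) :=
    ⟨⟨_, BinaryFan.isLimitMk
      (fst := ofLin (M := prod M N) (LinearMap.fst Rᵐᵒᵖ M.carrier N.carrier) fun _ _ h => h.1)
      (snd := ofLin (M := prod M N) (LinearMap.snd Rᵐᵒᵖ M.carrier N.carrier) fun _ _ h => h.2)
      (fun s => ofLin (N := prod M N) ((lin s.fst).prod (lin s.snd))
        fun _ _ h => ⟨lin_mem s.fst h, lin_mem s.snd h⟩)
      (fun _ => rfl) (fun _ => rfl)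
      (fun _ _ h₁ h₂ => hom_ext fun x =>
        Prod.ext (congrArg (fun k => lin k x) h₁) (congrArg (fun k => lin k x) h₂))⟩⟩
  hasBinaryProducts_of_hasLimit_pair _

instance : HasFiniteProducts (GrModCat.{w} 𝒜) :=
  haveI : HasTerminal (GrModCat.{w} 𝒜) := HasZeroObject.hasTerminal
  hasFiniteProducts_of_has_binary_and_terminal

/-! ### The abelian structure -/

lemma injective_of_mono {M N : GrModCat.{w} 𝒜} (f : M ⟶ N) [Mono f] :
    Function.Injective (lin f) := by
  have h : kerι f = 0 := by
    rw [← cancel_mono f, kerι_comp, zero_comp]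
  refine (injective_iff_map_eq_zero _).2 fun m hm => ?_
  exact congrArg (fun k => lin k (⟨m, hm⟩ : LinearMap.ker (lin f))) h

lemma surjective_of_epi {M N : GrModCat.{w} 𝒜} (f : M ⟶ N) [Epi f] :
    Function.Surjective (lin f) := by
  have h : cokerπ f = 0 := by
    rw [← cancel_epi f, comp_cokerπ, comp_zero]
  intro n
  exact (Submodule.Quotient.mk_eq_zero _).1 (congrArg (fun k => lin k n) h)

lemma exists_lift {M N W : GrModCat.{w} 𝒜} (f : M ⟶ N) [Mono f] (g : W ⟶ N)
    (hg : g ≫ cokerπ f = 0) : ∃ l : W ⟶ M, l ≫ f = g := by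
  have hr : ∀ x, lin g x ∈ LinearMap.range (lin f) := fun x =>
    (Submodule.Quotient.mk_eq_zero _).1 (congrArg (fun k => lin k x) hg)
  let e := LinearEquiv.ofInjective (lin f) (injective_of_mono f)
  let l : W.carrier →ₗ[Rᵐᵒᵖ] M.carrier :=
    e.symm.toLinearMap ∘ₗ (lin g).codRestrict (LinearMap.range (lin f)) hr
  have hl : ∀ x, lin f (l x) = lin g x := fun x =>
    congrArg Subtype.val (e.apply_symm_apply ⟨lin g x, hr x⟩)
  refine ⟨ofLin l fun γ x hx => ?_, hom_ext hl⟩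
  have h2 : M.proj γ (l x) = l x := injective_of_mono f (by
    rw [lin_proj, hl, N.proj_same (lin_mem g hx)])
  rw [← h2]
  exact M.proj_mem γ _

lemma exists_desc {M N W : GrModCat.{w} 𝒜} (f : M ⟶ N) [Epi f] (g : M ⟶ W)
    (hg : kerι f ≫ g = 0) : ∃ l : N ⟶ W, f ≫ l = g := by
  have hk : LinearMap.ker (lin f) ≤ LinearMap.ker (lin g) := fun x hx =>
    congrArg (fun k : ker f ⟶ W => lin k (⟨x, hx⟩ : LinearMap.ker (lin f))) hg
  let e := (lin f).quotKerEquivOfSurjective (surjective_of_epi f)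
  let l : N.carrier →ₗ[Rᵐᵒᵖ] W.carrier :=
    (LinearMap.ker (lin f)).liftQ (lin g) hk ∘ₗ e.symm.toLinearMap
  have hl : ∀ m, l (lin f m) = lin g m := fun m =>
    congrArg ((LinearMap.ker (lin f)).liftQ (lin g) hk)
      (e.symm_apply_apply ((LinearMap.ker (lin f)).mkQ m))
  refine ⟨ofLin l fun γ n hn => ?_, hom_ext hl⟩
  obtain ⟨m, rfl⟩ := surjective_of_epi f n
  have h : lin f (M.proj γ m) = lin f m := by rw [lin_proj, N.proj_same hn]
  rw [← h, hl]
  exact lin_mem g (M.proj_mem γ m)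

/-- A monomorphism is the kernel of its cokernel. -/
@[reducible] noncomputable def normalMono {M N : GrModCat.{w} 𝒜} (f : M ⟶ N) [Mono f] :
    NormalMono f where
  Z := coker f
  g := cokerπ f
  w := comp_cokerπ f
  isLimit := KernelFork.IsLimit.ofι _ _
    (fun g hg => (exists_lift f g hg).choose)
    (fun g hg => (exists_lift f g hg).choose_spec)
    (fun g hg m hm => by
      rw [← cancel_mono f, hm]
      exact (exists_lift f g hg).choose_spec.symm)

/-- An epimorphism is the cokernel of its kernel. -/
@[reducible] noncomputable def normalEpi {M N : GrModCat.{w} 𝒜} (f : M ⟶ N) [Epi f] :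
    NormalEpi f where
  W := ker f
  g := kerι f
  w := kerι_comp f
  isColimit := CokernelCofork.IsColimit.ofπ _ _
    (fun g hg => (exists_desc f g hg).choose)
    (fun g hg => (exists_desc f g hg).choose_spec)
    (fun g hg m hm => by
      rw [← cancel_epi f, hm]
      exact (exists_desc f g hg).choose_spec.symm)

/-- The category of graded right modules is abelian. -/
noncomputable instance : Abelian (GrModCat.{w} 𝒜) where
  normalMonoOfMono f _ := ⟨normalMono f⟩
  normalEpiOfEpi f _ := ⟨normalEpi f⟩

end GrModCat

/-! ## Localizing subcategories and generation by injectives -/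

namespace InjGen

open Pretriangulated

section

variable {T : Type u} [Category.{v} T] [HasZeroObject T] [HasShift T ℤ] [Preadditive T]
  [∀ n : ℤ, (shiftFunctor T n).Additive] [Pretriangulated T]

/-- A localizing subcategory of a triangulated category `T` (given by its objects): a strictly full
triangulated subcategory closed under all coproducts in `T` of families indexed by a set, that is,
by a type in `Type w`. -/
structure IsLocalizing (P : ObjectProperty T) : Prop where
  isTriangulated : P.IsTriangulated
  isClosedUnderIsomorphisms : P.IsClosedUnderIsomorphisms
  isClosedUnderCoproducts : ∀ J : Type w, P.IsClosedUnderColimitsOfShape (Discrete J)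

/-- `Loc S`, the smallest localizing subcategory of `T` that contains the class of objects `S`. -/
def Loc (S : ObjectProperty T) : ObjectProperty T :=
  fun X => ∀ P : ObjectProperty T, IsLocalizing.{w} P → S ≤ P → P X

lemma le_loc (S : ObjectProperty T) : S ≤ Loc.{w} S := fun _ hX _ _ hS => hS _ hX

lemma loc_le {S P : ObjectProperty T} (hP : IsLocalizing.{w} P) (hS : S ≤ P) : Loc.{w} S ≤ P :=
  fun _ hX => hX P hP hS

lemma isLocalizing_loc (S : ObjectProperty T) : IsLocalizing.{w} (Loc.{w} S) := by
  have hiso : (Loc.{w} S).IsClosedUnderIsomorphisms :=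
    ⟨fun e hX P hP hS => hP.isClosedUnderIsomorphisms.of_iso e (hX P hP hS)⟩
  refine ⟨?_, hiso, fun J => ⟨?_⟩⟩
  · exact
      { exists_zero := ⟨_, isZero_zero T, fun P hP _ =>
          haveI := hP.isTriangulated
          haveI := hP.isClosedUnderIsomorphisms
          P.prop_zero⟩
        isStableUnderShiftBy := fun n => ⟨fun X hX P hP hS =>
          haveI := hP.isTriangulated
          P.le_shift n X (hX P hP hS)⟩
        ext₂' := fun t ht h₁ h₃ => ObjectProperty.le_isoClosure _ _ fun P hP hS =>
          haveI := hP.isTriangulated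
          haveI := hP.isClosedUnderIsomorphisms
          P.ext_of_isTriangulatedClosed₂ t ht (h₁ P hP hS) (h₃ P hP hS) }
  · rintro X ⟨h⟩ P hP hS
    haveI := hP.isClosedUnderCoproducts J
    exact P.prop_of_isColimit h.isColimit fun j => h.prop_diag_obj j P hP hS

end

/-- The objects of the derived category `D(A)` isomorphic to an injective object of `A`, viewed as
a complex concentrated in degree `0`. -/
def injectivesInDegreeZero (A : Type u) [Category.{v} A] [Abelian A] [HasDerivedCategory.{w} A] :
    ObjectProperty (DerivedCategory A) :=
  fun X => ∃ I : A, Injective I ∧ Nonempty (X ≅ (DerivedCategory.singleFunctor A 0).obj I)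

/-- `Loc(Inj A) = D(A)` for an abelian category `A`; coproducts are indexed by types in the universe
of the morphisms of `A`. -/
def InjectivesGenerate (A : Type u) [Category.{v} A] [Abelian A] [HasDerivedCategory.{w} A] : Prop :=
  Loc.{v} (injectivesInDegreeZero A) = ⊤

/-- Injectives generate for the ring `R`: `Loc(Inj R) = D(Mod R)`, where `Mod R` is the category of
right `R`-modules. -/
def RingInjectivesGenerate (R : Type u) [Ring R] [HasDerivedCategory.{w} (ModuleCat.{u} Rᵐᵒᵖ)] : Prop :=
  InjectivesGenerate (ModuleCat.{u} Rᵐᵒᵖ)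

/-- Graded injectives generate for the graded ring `R` with homogeneous components `𝒜`:
`Loc(GrInj R) = D(GrMod R)`, where `GrMod R` is the category of graded right `R`-modules. -/
def GradedInjectivesGenerate {Γ : Type u} [AddCommGroup Γ] [DecidableEq Γ] {R : Type u} [Ring R]
    (𝒜 : Γ → AddSubgroup R) [GradedRing 𝒜] [HasDerivedCategory.{w} (GrModCat.{u} 𝒜)] : Prop :=
  InjectivesGenerate (GrModCat.{u} 𝒜)

end InjGen

/-!
Forgetting the grading is an exact functor `U : GrMod R ⥤ Mod R`. It has a right adjoint, the cofree
functor `C : Mod R ⥤ GrMod R`, which sends `N` to the direct sum of copies of `N` indexed by the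
grading group, an element of `R` of degree `γ'` carrying the copy of index `γ` to that of index
`γ + γ'`. The functor `C` is exact and preserves coproducts, and it preserves injectives because its
left adjoint `U` is exact. Hence it induces a triangulated, coproduct-preserving functor between the
derived categories that sends `Inj R` into `GrInj R`. The preimage of `Loc (GrInj R)` under this
functor is a localizing subcategory that contains `Inj R`, so if injectives generate for `R`, then
`C X` lies in `Loc (GrInj R)` for every complex `X` of `R`-modules.

Forgetting the grading and applying `C` loses nothing: the unit `M ⟶ C (U M)` is split by a natural
retraction, the projection of the copy of index `γ` onto the component `M_γ` (`retraction`,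
`unit_comp_retraction`). So every complex of graded modules is a retract of one in `Loc (GrInj R)`,
and localizing subcategories are closed under retracts by the Eilenberg swindle
(`IsLocalizing.prop_of_retract`). The formal part of the argument is `InjectivesGenerate.of_retract`.

The remaining input concerns coproducts in the derived category. If coproducts in an abelian
category are exact, the localization functor from complexes to the derived category preserves them
(`DerivedCategory.preservesCoproducts_Q`): morphisms in the derived category are fractions, and a
family of quasi-isomorphisms, or of null-homotopies, can be summed. For graded modules, coproducts
exist because `U` is comonadic, and they are exact because `U` is exact and conservative.
-/

/-! ### Coproducts in the derived category -/

namespace HomologicalComplex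

variable {C : Type*} [Category* C] {ι : Type*} (c : ComplexShape ι) {J : Type*} [Category* J]

section

variable [HasZeroMorphisms C]

/-- A diagram of complexes, regarded as a complex of diagrams. -/
@[simps]
def ofDiagram (K : J ⥤ HomologicalComplex C c) : HomologicalComplex (J ⥤ C) c where
  X i := K ⋙ eval C c i
  d i j :=
    { app := fun k => (K.obj k).d i j
      naturality := fun _ _ f => (K.map f).comm i j }
  shape i j h := by
    ext k
    exact (K.obj k).shape i j h
  d_comp_d' i j l _ _ := by
    ext k
    exact (K.obj k).d_comp_d i j l

/-- The morphism of complexes of diagrams attached to a morphism of diagrams of complexes. -/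
@[simps]
def ofDiagramMap {K K' : J ⥤ HomologicalComplex C c} (φ : K ⟶ K') :
    ofDiagram c K ⟶ ofDiagram c K' where
  f i := Functor.whiskerRight φ (eval C c i)
  comm' i j _ := by
    ext k
    exact (φ.app k).comm i j

end

section

variable [Abelian C]

/-- A morphism of complexes of diagrams is a quasi-isomorphism if it is one at each vertex, because
evaluations are exact and jointly reflect isomorphisms. -/
lemma quasiIso_of_evaluation {K L : HomologicalComplex (J ⥤ C) c} (φ : K ⟶ L)
    (h : ∀ j, QuasiIso ((((evaluation J C).obj j).mapHomologicalComplex c).map φ)) :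
    QuasiIso φ := by
  rw [quasiIso_iff]
  intro i
  rw [quasiIsoAt_iff_isIso_homologyMap, NatTrans.isIso_iff_isIso_app]
  intro j
  have h' := (quasiIsoAt_iff_isIso_homologyMap _ i).1 ((h j).quasiIsoAt i)
  have e := ShortComplex.mapHomologyIso_hom_naturality ((shortComplexFunctor (J ⥤ C) c i).map φ)
    ((evaluation J C).obj j)
  have : IsIso (ShortComplex.homologyMap
    (((evaluation J C).obj j).mapShortComplex.map ((shortComplexFunctor (J ⥤ C) c i).map φ))) := h'
  change IsIso (((evaluation J C).obj j).map
    (ShortComplex.homologyMap ((shortComplexFunctor (J ⥤ C) c i).map φ)))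
  have h₂ := IsIso.comp_isIso' this
    (ShortComplex.mapHomologyIso ((shortComplexFunctor (J ⥤ C) c i).obj L)
      ((evaluation J C).obj j)).isIso_hom
  exact @IsIso.of_isIso_fac_left _ _ _ _ _ _ _ _
    (ShortComplex.mapHomologyIso ((shortComplexFunctor (J ⥤ C) c i).obj K)
      ((evaluation J C).obj j)).isIso_hom h₂ e.symm

/-- The colimit of a diagram of complexes is computed degreewise. -/
noncomputable def isoColimOfDiagram [HasColimitsOfShape J C] {K : J ⥤ HomologicalComplex C c}
    {t : Cocone K} (ht : IsColimit t) :
    (colim.mapHomologicalComplex c).obj (ofDiagram c K) ≅ t.pt :=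
  Hom.isoOfComponents
    (fun i => (colimit.isColimit (K ⋙ eval C c i)).coconePointUniqueUpToIso
      (isColimitOfPreserves (eval C c i) ht))
    (fun i j _ => by
      refine colimit.hom_ext fun k => ?_
      have h (i : ι) := (colimit.isColimit (K ⋙ eval C c i)).comp_coconePointUniqueUpToIso_hom
        (isColimitOfPreserves (eval C c i) ht) k
      refine (reassoc_of% h i) _ |>.trans ?_
      refine Eq.trans ?_ ((ι_colimMap_assoc ((ofDiagram c K).d i j) k _).trans
        (congrArg (_ ≫ ·) (h j))).symm
      exact (t.ι.app k).comm i j)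

lemma ι_isoColimOfDiagram_hom [HasColimitsOfShape J C] {K : J ⥤ HomologicalComplex C c}
    {t : Cocone K} (ht : IsColimit t) (i : ι) (k : J) :
    colimit.ι (K ⋙ eval C c i) k ≫ (isoColimOfDiagram c ht).hom.f i = (t.ι.app k).f i :=
  (colimit.isColimit (K ⋙ eval C c i)).comp_coconePointUniqueUpToIso_hom
    (isColimitOfPreserves (eval C c i) ht) k

/-- Quasi-isomorphisms are stable under exact colimits: the exact functor `colim` applied to
complexes of diagrams preserves quasi-isomorphisms. -/
lemma quasiIso_of_isColimit [HasColimitsOfShape J C] [HasExactColimitsOfShape J C]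
    {K K' : J ⥤ HomologicalComplex C c} {t : Cocone K} {t' : Cocone K'} (ht : IsColimit t)
    (ht' : IsColimit t') (φ : K ⟶ K') (hφ : ∀ j, QuasiIso (φ.app j)) (f : t.pt ⟶ t'.pt)
    (hf : ∀ j, t.ι.app j ≫ f = φ.app j ≫ t'.ι.app j) : QuasiIso f := by
  have : QuasiIso (ofDiagramMap c φ) := quasiIso_of_evaluation c _ hφ
  have h2 : QuasiIso ((colim.mapHomologicalComplex c).map (ofDiagramMap c φ)) := inferInstance
  refine (MorphismProperty.arrow_mk_iso_iff (quasiIso C c) (Arrow.isoMk (isoColimOfDiagram c ht)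
    (isoColimOfDiagram c ht') ?_)).1 h2
  ext i
  refine colimit.hom_ext fun k => ?_
  refine (Category.assoc _ _ _).symm.trans
    ((congrArg (· ≫ f.f i) (ι_isoColimOfDiagram_hom c ht i k)).trans ?_)
  refine (congr_hom (hf k) i).trans ?_
  refine Eq.trans ?_ (ι_colimMap_assoc ((ofDiagramMap c φ).f i) k _).symm
  exact congrArg ((φ.app k).f i ≫ ·) (ι_isoColimOfDiagram_hom c ht' i k).symm

end

section

variable [Preadditive C]

/-- A morphism out of a colimit of complexes over a discrete category is null-homotopic
if its restriction to each summand is. -/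
noncomputable def homotopyZeroOfIsColimit {J : Type*} [HasColimitsOfShape (Discrete J) C]
    {K : Discrete J ⥤ HomologicalComplex C c} {t : Cocone K} (ht : IsColimit t)
    {L : HomologicalComplex C c} (f : t.pt ⟶ L) (h : ∀ j, Homotopy (t.ι.app j ≫ f) 0) :
    Homotopy f 0 :=
  let desc (i i' : ι) : t.pt.X i ⟶ L.X i' := (isColimitOfPreserves (eval C c i) ht).desc
    ⟨L.X i', Discrete.natTrans fun j => (h j).hom i i'⟩
  have fac (i i' : ι) (j : Discrete J) : (t.ι.app j).f i ≫ desc i i' = (h j).hom i i' :=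
    (isColimitOfPreserves (eval C c i) ht).fac _ j
  have ext {i : ι} {Z : C} {a b : t.pt.X i ⟶ Z}
      (hab : ∀ j, (t.ι.app j).f i ≫ a = (t.ι.app j).f i ≫ b) : a = b :=
    (isColimitOfPreserves (eval C c i) ht).hom_ext hab
  { hom := desc
    zero := fun i i' hi => ext fun j => by rw [fac, (h j).zero i i' hi, comp_zero]
    comm := fun i => ext fun j => by
      have e : (h j).hom = fun i i' => (t.ι.app j).f i ≫ desc i i' := by
        ext i i'
        exact (fac i i' j).symm
      have := (h j).comm i
      rw [e, dNext_comp_left, prevD_comp_left] at this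
      simpa using this }

end

end HomologicalComplex

namespace DerivedCategory

variable {C : Type u} [Category.{v} C] [Abelian C] [HasDerivedCategory.{w} C]

/-- A morphism of complexes that vanishes in the derived category becomes null-homotopic after
composition with a quasi-isomorphism. -/
lemma exists_homotopy_of_Q_map_eq_zero {K L : CochainComplex C ℤ} (f : K ⟶ L)
    (hf : Q.map f = 0) :
    ∃ (K' : CochainComplex C ℤ) (s : K' ⟶ K) (_ : QuasiIso s), Nonempty (Homotopy (s ≫ f) 0) := by
  have h : Qh.map ((HomotopyCategory.quotient _ _).map f) = Qh.map 0 := by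
    rw [Functor.map_zero]
    exact hf
  rw [MorphismProperty.map_eq_iff_precomp Qh (HomotopyCategory.quasiIso C (ComplexShape.up ℤ))] at h
  obtain ⟨K', s, hs, e⟩ := h
  obtain ⟨K', rfl⟩ := HomotopyCategory.quotient_obj_surjective K'
  obtain ⟨s, rfl⟩ := (HomotopyCategory.quotient _ _).map_surjective s
  rw [HomotopyCategory.quotient_map_mem_quasiIso_iff] at hs
  refine ⟨K', s, hs, ⟨HomotopyCategory.homotopyOfEq _ _ ?_⟩⟩
  rw [Functor.map_comp, e, comp_zero, Functor.map_zero]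

variable {J : Type*} [HasColimitsOfShape (Discrete J) C] [HasExactColimitsOfShape (Discrete J) C]

/-- If coproducts in `C` are exact, then the coproduct of a family of complexes
is also their coproduct in the derived category, by the calculus of fractions. -/
instance preservesCoproducts_Q :
    PreservesColimitsOfShape (Discrete J) (Q : CochainComplex C ℤ ⥤ DerivedCategory C) where
  preservesColimit {K} := ⟨fun {t} ht => ⟨IsColimit.ofExistsUnique fun s => by
    have resolve : ∀ (X : J → CochainComplex C ℤ) (σ : ∀ j, X j ⟶ K.obj ⟨j⟩)
        (_ : ∀ j, QuasiIso (σ j)), ∃ t' : ColimitCocone (Discrete.functor X),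
        ∃ f : t'.cocone.pt ⟶ t.pt, QuasiIso f ∧
          ∀ j, t'.cocone.ι.app ⟨j⟩ ≫ f = σ j ≫ t.ι.app ⟨j⟩ := by
      intro X σ hσ
      let t' := getColimitCocone (Discrete.functor X)
      let φ : Discrete.functor X ⟶ K := Discrete.natTrans fun j => σ j.as
      refine ⟨t', t'.isColimit.desc ((Cocone.precompose φ).obj t), ?_, fun j => ?_⟩
      · exact HomologicalComplex.quasiIso_of_isColimit _ t'.isColimit ht φ (fun j => hσ j.as) _
          fun j => t'.isColimit.fac _ j
      · exact t'.isColimit.fac _ ⟨j⟩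
    -- A family of resolutions of the summands sums to a resolution of the coproduct. Existence and
    -- uniqueness both apply this to the denominators obtained for the individual summands.
    refine existsUnique_of_exists_of_unique ?_ ?_
    · let e := Q.objObjPreimageIso s.pt
      have h (j : J) := right_fac (s.ι.app ⟨j⟩ ≫ e.inv)
      choose X σ hσ g hg using h
      obtain ⟨t', f, hf, hf'⟩ := resolve X σ fun j => (isIso_Q_map_iff_quasiIso C (σ j)).1 (hσ j)
      obtain ⟨d, hd⟩ : ∃ d : t'.cocone.pt ⟶ _, ∀ j, t'.cocone.ι.app ⟨j⟩ ≫ d = g j :=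
        ⟨t'.isColimit.desc ⟨_, Discrete.natTrans fun j => g j.as⟩,
          fun j => t'.isColimit.fac _ ⟨j⟩⟩
      refine ⟨inv (Q.map f) ≫ Q.map d ≫ e.hom, ?_⟩
      rintro ⟨j⟩
      have h₁ : Q.map (t.ι.app ⟨j⟩) ≫ inv (Q.map f) =
          inv (Q.map (σ j)) ≫ Q.map (t'.cocone.ι.app ⟨j⟩) := by
        rw [IsIso.comp_inv_eq, Category.assoc, IsIso.eq_inv_comp, ← Q.map_comp, ← Q.map_comp, hf']
      change Q.map (t.ι.app ⟨j⟩) ≫ _ = _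
      rw [reassoc_of% h₁, ← Q.map_comp_assoc, hd, ← Category.assoc, ← hg, Category.assoc,
        e.inv_hom_id]
      exact Category.comp_id _
    · intro d₁ d₂ h₁ h₂
      let e := Q.objObjPreimageIso s.pt
      obtain ⟨L, g, σ, hσ, hg⟩ := left_fac ((d₁ - d₂) ≫ e.inv)
      have hz (j : J) : Q.map (t.ι.app ⟨j⟩ ≫ g) = 0 := by
        have h₀ : Q.map (t.ι.app ⟨j⟩) ≫ (d₁ - d₂) = 0 := by
          rw [Preadditive.comp_sub, sub_eq_zero]
          exact (h₁ ⟨j⟩).trans (h₂ ⟨j⟩).symm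
        rw [← cancel_mono (inv (Q.map σ)), zero_comp, Q.map_comp, Category.assoc, ← hg,
          reassoc_of% h₀, zero_comp]
      choose X τ hτ H using fun j => exists_homotopy_of_Q_map_eq_zero _ (hz j)
      obtain ⟨t', f, hf, hf'⟩ := resolve X τ hτ
      have hfg : Q.map (f ≫ g) = 0 := by
        rw [Q_map_eq_of_homotopy C (HomologicalComplex.homotopyZeroOfIsColimit _ t'.isColimit (f ≫ g)
          fun j => (Homotopy.ofEq (by rw [reassoc_of% (hf' j.as)])).trans (H j.as).some),
          Functor.map_zero]
      have hg0 : Q.map g = 0 := by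
        rwa [Q.map_comp, Preadditive.IsIso.comp_left_eq_zero] at hfg
      rw [← sub_eq_zero, ← cancel_mono e.inv, hg, hg0, zero_comp, zero_comp]⟩⟩

instance hasCoproductsOfShape : HasColimitsOfShape (Discrete J) (DerivedCategory C) where
  has_colimit F := by
    let K : Discrete J ⥤ CochainComplex C ℤ :=
      Discrete.functor fun j => Q.objPreimage (F.obj ⟨j⟩)
    let e : K ⋙ Q ≅ F := Discrete.natIso fun j => Q.objObjPreimageIso (F.obj j)
    exact hasColimit_of_iso e.symm

end DerivedCategory

/-! ### Localizing subcategories and retracts -/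

instance preservesCoproducts_mapDerivedCategory {A : Type*} {B : Type*} [Category* A]
    [Category* B] [Abelian A] [Abelian B] [HasDerivedCategory A] [HasDerivedCategory B]
    {J : Type*} [HasColimitsOfShape (Discrete J) A] [HasExactColimitsOfShape (Discrete J) A]
    [HasColimitsOfShape (Discrete J) B] [HasExactColimitsOfShape (Discrete J) B]
    (F : A ⥤ B) [F.Additive] [PreservesFiniteLimits F] [PreservesFiniteColimits F]
    [PreservesColimitsOfShape (Discrete J) F] :
    PreservesColimitsOfShape (Discrete J) F.mapDerivedCategory where
  preservesColimit {F'} := by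
    let K : Discrete J ⥤ CochainComplex A ℤ :=
      Discrete.functor fun j => DerivedCategory.Q.objPreimage (F'.obj ⟨j⟩)
    let e : K ⋙ DerivedCategory.Q ≅ F' :=
      Discrete.natIso fun j => DerivedCategory.Q.objObjPreimageIso (F'.obj j)
    have : PreservesColimit K (DerivedCategory.Q ⋙ F.mapDerivedCategory) :=
      preservesColimit_of_natIso K F.mapDerivedCategoryFactors.symm
    have : PreservesColimit (K ⋙ DerivedCategory.Q) F.mapDerivedCategory :=
      preservesColimit_of_preserves_colimit_cocone
        (isColimitOfPreserves DerivedCategory.Q (colimit.isColimit K))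
        (isColimitOfPreserves (DerivedCategory.Q ⋙ F.mapDerivedCategory) (colimit.isColimit K))
    exact preservesColimit_of_iso_diagram _ e

namespace InjGen

open Pretriangulated

section

/-- If `Z` has a retract `X`, then `∐ Z ≅ X ⊞ ∐ Z`, the coproducts being countable. -/
lemma nonempty_iso_biprod_sigma {T : Type*} [Category* T] [Preadditive T] [HasBinaryBiproducts T]
    {X Z : T} (r : Retract X Z) {c : Cofan fun _ : ULift.{w} ℕ => Z} (hc : IsColimit c) :
    Nonempty (c.pt ≅ X ⊞ c.pt) := by
  let e : Z ⟶ Z := r.r ≫ r.i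
  have he : e ≫ e = e := by simp [e]
  have her : e ≫ r.r = r.r := by simp [e]
  have hie : r.i ≫ e = r.i := by simp [e]
  let f : ∀ n : ℕ, Z ⟶ X ⊞ c.pt := fun n => match n with
    | 0 => r.r ≫ biprod.inl + (𝟙 Z - e) ≫ c.inj ⟨0⟩ ≫ biprod.inr
    | n + 1 => ((𝟙 Z - e) ≫ c.inj ⟨n + 1⟩ + e ≫ c.inj ⟨n⟩) ≫ biprod.inr
  let F : c.pt ⟶ X ⊞ c.pt := Cofan.IsColimit.desc hc fun n => f n.down
  let g : c.pt ⟶ c.pt := Cofan.IsColimit.desc hc fun n =>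
    (𝟙 Z - e) ≫ c.inj n + e ≫ c.inj ⟨n.down + 1⟩
  have hF (n : ℕ) : c.inj ⟨n⟩ ≫ F = f n := Cofan.IsColimit.fac hc _ ⟨n⟩
  have hg (n : ℕ) : c.inj ⟨n⟩ ≫ g = (𝟙 Z - e) ≫ c.inj ⟨n⟩ + e ≫ c.inj ⟨n + 1⟩ :=
    Cofan.IsColimit.fac hc _ ⟨n⟩
  -- With `e` the idempotent of `Z` with image `X`, the map `F` splits `X` off the copy of `Z` of
  -- index `0` and moves the `e`-part of the copy of index `n + 1` to index `n`; `g` moves it back.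
  refine ⟨⟨F, biprod.desc (r.i ≫ c.inj ⟨0⟩) g, ?_, ?_⟩⟩
  · refine Cofan.IsColimit.hom_ext hc _ _ fun ⟨n⟩ => ?_
    rw [reassoc_of% hF n]
    rcases n with _ | n
    · simp [f, hg, Preadditive.sub_comp, Preadditive.comp_sub, reassoc_of% he]
      simp [e]
    · simp [f, hg, Preadditive.sub_comp, Preadditive.comp_sub, reassoc_of% he]
  · ext : 1
    · simp [hF, f, Preadditive.comp_sub, Preadditive.sub_comp, reassoc_of% hie]
    · simp only [biprod.inr_desc_assoc, Category.comp_id]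
      refine Cofan.IsColimit.hom_ext hc _ _ fun ⟨n⟩ => ?_
      rw [reassoc_of% hg n]
      rcases n with _ | n
      · simp [f, hF, Preadditive.sub_comp, Preadditive.comp_sub, reassoc_of% he, reassoc_of% her]
      · simp [f, hF, Preadditive.sub_comp, Preadditive.comp_sub, reassoc_of% he]

variable {T : Type u} [Category.{v} T] [HasZeroObject T] [HasShift T ℤ] [Preadditive T]
  [∀ n : ℤ, (shiftFunctor T n).Additive] [Pretriangulated T]

/-- Localizing subcategories are closed under retracts, by the Eilenberg swindle. -/
lemma IsLocalizing.prop_of_retract [HasColimitsOfShape (Discrete (ULift.{w} ℕ)) T]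
    {P : ObjectProperty T} (hP : IsLocalizing.{w} P) {X Z : T} (r : Retract X Z) (hZ : P Z) :
    P X := by
  have := hP.isTriangulated
  have := hP.isClosedUnderIsomorphisms
  have := hP.isClosedUnderCoproducts (ULift.{w} ℕ)
  let c := getColimitCocone (Discrete.functor fun _ : ULift.{w} ℕ => Z)
  have hc : P c.cocone.pt := P.prop_of_isColimit c.isColimit fun _ => hZ
  obtain ⟨e⟩ := nonempty_iso_biprod_sigma r c.isColimit
  exact P.ext_of_isTriangulatedClosed₁ _ (binaryBiproductTriangle_distinguished X c.cocone.pt)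
    (P.prop_of_iso e hc) hc

end

/-- The preimage of a localizing subcategory under a triangulated functor that preserves
coproducts is localizing. -/
lemma IsLocalizing.inverseImage {T T' : Type*} [Category* T] [HasZeroObject T] [HasShift T ℤ]
    [Preadditive T] [∀ n : ℤ, (shiftFunctor T n).Additive] [Pretriangulated T]
    [Category* T'] [HasZeroObject T'] [HasShift T' ℤ]
    [Preadditive T'] [∀ n : ℤ, (shiftFunctor T' n).Additive] [Pretriangulated T']
    (F : T ⥤ T') [F.CommShift ℤ] [F.IsTriangulated]
    [∀ J : Type w, PreservesColimitsOfShape (Discrete J) F]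
    {P : ObjectProperty T'} (hP : IsLocalizing.{w} P) : IsLocalizing.{w} (P.inverseImage F) where
  isTriangulated := have := hP.isTriangulated; have := hP.isClosedUnderIsomorphisms; inferInstance
  isClosedUnderIsomorphisms := have := hP.isClosedUnderIsomorphisms; inferInstance
  isClosedUnderCoproducts J := have := hP.isClosedUnderCoproducts J; inferInstance

/-- Generation by injectives passes from `A` to `B` along an exact functor `G : A ⥤ B` that
preserves coproducts and injectives, provided that every object of `B` is a natural retract
of an object in the image of `G`. -/
theorem InjectivesGenerate.of_retract {A B : Type u} [Category.{v} A] [Category.{v} B] [Abelian A]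
    [Abelian B] [HasDerivedCategory.{w} A] [HasDerivedCategory.{w'} B]
    [HasCoproducts.{v} A] [HasCoproducts.{v} B] [AB4 A] [AB4 B]
    (G : A ⥤ B) [G.Additive] [PreservesFiniteLimits G] [PreservesFiniteColimits G]
    [∀ J : Type v, PreservesColimitsOfShape (Discrete J) G] [G.PreservesInjectiveObjects]
    (L : B ⥤ A) [L.Additive] (i : 𝟭 B ⟶ L ⋙ G) (r : L ⋙ G ⟶ 𝟭 B) (h : i ≫ r = 𝟙 _)
    (hA : InjectivesGenerate A) : InjectivesGenerate B := by
  have hle : Loc.{v} (injectivesInDegreeZero A) ≤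
      (Loc.{v} (injectivesInDegreeZero B)).inverseImage G.mapDerivedCategory := by
    refine loc_le ((isLocalizing_loc _).inverseImage _) ?_
    rintro X ⟨I, hI, ⟨e⟩⟩
    exact le_loc _ _ ⟨G.obj I, G.injective_obj I, ⟨G.mapDerivedCategory.mapIso e ≪≫
      (G.mapDerivedCategorySingleFunctor 0).app I⟩⟩
  rw [InjectivesGenerate, eq_top_iff]
  intro X _
  let K := DerivedCategory.Q.objPreimage X
  let M := (L.mapHomologicalComplex (ComplexShape.up ℤ)).obj K
  have hM : Loc.{v} (injectivesInDegreeZero B)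
      (G.mapDerivedCategory.obj (DerivedCategory.Q.obj M)) := by
    refine hle _ ?_
    rw [hA]
    trivial
  have ret : Retract K ((G.mapHomologicalComplex (ComplexShape.up ℤ)).obj M) :=
    { i := { f := fun n => i.app (K.X n), comm' := fun a b _ => (i.naturality (K.d a b)).symm }
      r := { f := fun n => r.app (K.X n), comm' := fun a b _ => (r.naturality (K.d a b)).symm }
      retract := by
        ext n
        exact congr_app h (K.X n) }
  have := (isLocalizing_loc.{v} (injectivesInDegreeZero B)).isClosedUnderIsomorphisms
  refine ObjectProperty.prop_of_iso _ (DerivedCategory.Q.objObjPreimageIso X) ?_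
  exact (isLocalizing_loc _).prop_of_retract (ret.map DerivedCategory.Q)
    (ObjectProperty.prop_of_iso _ (G.mapDerivedCategoryFactors.app M) hM)

end InjGen

/-! ### Cofree graded modules -/

namespace GrModCat

section

variable {Γ : Type v} [AddCommGroup Γ] [DecidableEq Γ] {R : Type u} [Ring R]
  {𝒜 : Γ → AddSubgroup R}

/-- Additive maps out of a graded module are determined by the homogeneous elements. -/
lemma addHom_ext {M : GrModCat.{w} 𝒜} {P : Type*} [AddCommMonoid P] {f g : M.carrier →+ P}
    (h : ∀ γ, ∀ m ∈ M.grading γ, f m = g m) : f = g := by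
  ext m
  obtain ⟨s, hs⟩ := M.sum_proj m
  rw [hs s subset_rfl, map_sum, map_sum]
  exact Finset.sum_congr rfl fun γ _ => h γ _ (M.proj_mem γ m)

lemma proj_op_smul (M : GrModCat.{w} 𝒜) {γ' : Γ} {r : R} (hr : r ∈ 𝒜 γ') (γ : Γ) (m : M.carrier) :
    M.proj (γ + γ') (MulOpposite.op r • m) = MulOpposite.op r • M.proj γ m := by
  refine DFunLike.congr_fun (f := (M.proj (γ + γ')).comp
    (DistribSMul.toAddMonoidHom M.carrier (MulOpposite.op r)))
    (g := (DistribSMul.toAddMonoidHom M.carrier (MulOpposite.op r)).comp (M.proj γ)) ?_ m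
  refine addHom_ext fun δ m hm => ?_
  change M.proj (γ + γ') (MulOpposite.op r • m) = MulOpposite.op r • M.proj γ m
  by_cases h : δ = γ
  · subst h
    rw [M.proj_same hm, M.proj_same (M.smul_mem hm hr)]
  · rw [M.proj_ne h hm, M.proj_ne (by simpa using h) (M.smul_mem hm hr), smul_zero]

/-- The additive map out of a graded module with prescribed restrictions to its components. -/
noncomputable def addHomOfComponents (M : GrModCat.{w} 𝒜) {P : Type*} [AddCommMonoid P]
    (f : Γ → M.carrier →+ P) : M.carrier →+ P :=
  letI := M.isInternal.chooseDecomposition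
  (DirectSum.toAddMonoid fun γ => (f γ).comp (M.grading γ).subtype).comp
    (DirectSum.decomposeAddEquiv M.grading).toAddMonoidHom

lemma addHomOfComponents_of_mem (M : GrModCat.{w} 𝒜) {P : Type*} [AddCommMonoid P]
    (f : Γ → M.carrier →+ P) {γ : Γ} {m : M.carrier} (hm : m ∈ M.grading γ) :
    M.addHomOfComponents f m = f γ m := by
  let := M.isInternal.chooseDecomposition
  change DirectSum.toAddMonoid _ (DirectSum.decompose M.grading m) = _
  rw [DirectSum.decompose_of_mem _ hm, DirectSum.toAddMonoid_of]
  rfl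

/-- For a graded ring, an additive map between right modules is linear as soon as it commutes with
the action of homogeneous elements. -/
def linearOfHomogeneous (𝒜 : Γ → AddSubgroup R) [GradedRing 𝒜] {M N : Type*} [AddCommGroup M]
    [AddCommGroup N] [Module Rᵐᵒᵖ M] [Module Rᵐᵒᵖ N] (f : M →+ N)
    (h : ∀ γ, ∀ r ∈ 𝒜 γ, ∀ m, f (MulOpposite.op r • m) = MulOpposite.op r • f m) :
    M →ₗ[Rᵐᵒᵖ] N where
  toFun := f
  map_add' := map_add f
  map_smul' r m := by
    induction r using MulOpposite.rec' with | _ r => ?_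
    induction r using DirectSum.Decomposition.inductionOn 𝒜 with
    | zero => simp
    | homogeneous r => exact h _ _ r.2 m
    | add r s hr hs =>
      simp only [RingHom.id_apply] at hr hs ⊢
      rw [MulOpposite.op_add, add_smul, add_smul, map_add, hr, hs]

end

variable {Γ : Type v} {R : Type u} [Ring R] (𝒜 : Γ → AddSubgroup R)

/-- The direct sum of copies `N γ` of `N` indexed by the grading group, the carrier of the cofree
graded module on a module `N`. It is a type synonym because the action of `R` is not the diagonal
one: a homogeneous element of degree `γ'` maps the copy of index `γ` to that of index `γ + γ'`. -/
def Cofree (_ : Γ → AddSubgroup R) (N : Type*) [AddCommGroup N] : Type _ := Γ →₀ N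

namespace Cofree

section

variable (N : Type*) [AddCommGroup N]

noncomputable instance : AddCommGroup (Cofree 𝒜 N) := inferInstanceAs (AddCommGroup (Γ →₀ N))

variable {N}

/-- The inclusion of the copy of index `γ`. -/
noncomputable def single (γ : Γ) : N →+ Cofree 𝒜 N := Finsupp.singleAddHom γ

/-- The projection to the copy of index `γ`. -/
noncomputable def component (γ : Γ) : Cofree 𝒜 N →+ N := Finsupp.applyAddHom γ

variable {𝒜} in
/-- The additive map with prescribed restrictions to all copies. -/
noncomputable def lift {P : Type*} [AddCommMonoid P] (f : Γ → N →+ P) : Cofree 𝒜 N →+ P :=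
  Finsupp.liftAddHom f

@[simp] lemma lift_single {P : Type*} [AddCommMonoid P] (f : Γ → N →+ P) (γ : Γ) (n : N) :
    lift f (single 𝒜 γ n) = f γ n := Finsupp.liftAddHom_apply_single f γ n

lemma component_single_same (γ : Γ) (n : N) : component 𝒜 γ (single 𝒜 γ n) = n :=
  Finsupp.single_eq_same

lemma component_single_ne {γ γ' : Γ} (h : γ ≠ γ') (n : N) :
    component 𝒜 γ' (single 𝒜 γ n) = 0 :=
  Finsupp.single_eq_of_ne (Ne.symm h)

variable {𝒜} in
lemma hom_ext {P : Type*} [AddCommMonoid P] {f g : Cofree 𝒜 N →+ P}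
    (h : ∀ γ n, f (single 𝒜 γ n) = g (single 𝒜 γ n)) : f = g :=
  Finsupp.addHom_ext h

variable {𝒜} in
lemma end_ext {f g : AddMonoid.End (Cofree 𝒜 N)}
    (h : ∀ γ n, f (single 𝒜 γ n) = g (single 𝒜 γ n)) : f = g :=
  hom_ext h

lemma sum_single_component (x : Cofree 𝒜 N) :
    ∃ s : Finset Γ, x = ∑ γ ∈ s, single 𝒜 γ (component 𝒜 γ x) :=
  ⟨Finsupp.support x, (Finsupp.sum_single (show Γ →₀ N from x)).symm⟩

end

variable [AddCommGroup Γ] (N : Type*) [AddCommGroup N] [Module Rᵐᵒᵖ N]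

/-- The right action of the homogeneous elements of degree `γ'`. -/
noncomputable def homogeneousAction (γ' : Γ) : 𝒜 γ' →+ (AddMonoid.End (Cofree 𝒜 N))ᵐᵒᵖ :=
  MulOpposite.opAddEquiv.toAddMonoidHom.comp
    (AddMonoidHom.mk'
      (fun r => lift fun γ => (single 𝒜 (γ + γ')).comp
        (DistribSMul.toAddMonoidHom N (MulOpposite.op (r : R))))
      fun r s => hom_ext fun γ n => by
        rw [AddMonoidHom.add_apply]
        simp [add_smul])

lemma unop_homogeneousAction_single (γ' : Γ) (r : 𝒜 γ') (γ : Γ) (n : N) :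
    (homogeneousAction 𝒜 N γ' r).unop (single 𝒜 γ n) =
      single 𝒜 (γ + γ') (MulOpposite.op (r : R) • n) :=
  lift_single 𝒜 _ γ n

variable [DecidableEq Γ] [GradedRing 𝒜]

/-- The right action of `R`, valued in the opposite of the endomorphism ring because `R` acts from
the right. -/
noncomputable def action : R →+* (AddMonoid.End (Cofree 𝒜 N))ᵐᵒᵖ :=
  (DirectSum.toSemiring (homogeneousAction 𝒜 N)
    (MulOpposite.unop_injective (end_ext fun γ n => by
      rw [unop_homogeneousAction_single, add_zero, SetLike.coe_gOne, MulOpposite.op_one, one_smul]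
      rfl))
    (fun {i j} r s => MulOpposite.unop_injective (end_ext fun γ n => by
      change _ = (homogeneousAction 𝒜 N j s).unop
        ((homogeneousAction 𝒜 N i r).unop (single 𝒜 γ n))
      rw [unop_homogeneousAction_single, unop_homogeneousAction_single,
        unop_homogeneousAction_single, SetLike.coe_gMul, MulOpposite.op_mul, mul_smul,
        add_assoc]))).comp
    (DirectSum.decomposeRingEquiv 𝒜).toRingHom

noncomputable instance : Module Rᵐᵒᵖ (Cofree 𝒜 N) :=
  Module.compHom _ ((RingEquiv.opOp _).symm.toRingHom.comp (RingHom.op (action 𝒜 N)))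

lemma op_smul_single {γ' : Γ} {r : R} (hr : r ∈ 𝒜 γ') (γ : Γ) (n : N) :
    MulOpposite.op r • single 𝒜 γ n = single 𝒜 (γ + γ') (MulOpposite.op r • n) := by
  refine Eq.trans ?_ (unop_homogeneousAction_single 𝒜 N γ' ⟨r, hr⟩ γ n)
  have h : action 𝒜 N r = homogeneousAction 𝒜 N γ' ⟨r, hr⟩ := by
    rw [action, RingHom.comp_apply, show (DirectSum.decomposeRingEquiv 𝒜).toRingHom r =
      DirectSum.of (fun i => 𝒜 i) γ' ⟨r, hr⟩ from DirectSum.decompose_of_mem _ hr]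
    exact DirectSum.toSemiring_of _ _ _ _ _
  rw [← h]
  rfl

end Cofree

variable [AddCommGroup Γ] [DecidableEq Γ] [GradedRing 𝒜]

/-- The cofree graded module on a module `N`: every component is a copy of `N`. -/
noncomputable def cofreeObj (N : Type*) [AddCommGroup N] [Module Rᵐᵒᵖ N] : GrModCat 𝒜 where
  carrier := Cofree 𝒜 N
  grading γ := (Cofree.single 𝒜 γ).range
  isInternal := by
    refine isInternal_of_proj _
      (fun γ => (Cofree.single 𝒜 γ).comp (Cofree.component 𝒜 γ)) ?_ ?_ ?_ ?_
    · exact fun γ x => ⟨_, rfl⟩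
    · rintro γ _ ⟨n, rfl⟩
      exact congrArg (Cofree.single 𝒜 γ) (Cofree.component_single_same 𝒜 γ n)
    · rintro γ γ' hne _ ⟨n, rfl⟩
      exact (congrArg (Cofree.single 𝒜 γ') (Cofree.component_single_ne 𝒜 hne n)).trans (map_zero _)
    · exact Cofree.sum_single_component 𝒜
  smul_mem := by
    rintro γ γ' _ r ⟨n, rfl⟩ hr
    exact ⟨_, (Cofree.op_smul_single 𝒜 N hr γ n).symm⟩

/-- The inclusion of the component of degree `γ` of a cofree graded module. -/
noncomputable def inc {N : Type*} [AddCommGroup N] [Module Rᵐᵒᵖ N] (γ : Γ) :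
    N →+ (cofreeObj 𝒜 N).carrier := Cofree.single 𝒜 γ

lemma inc_mem {N : Type*} [AddCommGroup N] [Module Rᵐᵒᵖ N] (γ : Γ) (n : N) :
    inc 𝒜 γ n ∈ (cofreeObj 𝒜 N).grading γ := ⟨n, rfl⟩

lemma op_smul_inc {N : Type*} [AddCommGroup N] [Module Rᵐᵒᵖ N] {γ' : Γ} {r : R} (hr : r ∈ 𝒜 γ')
    (γ : Γ) (n : N) : MulOpposite.op r • inc 𝒜 γ n = inc 𝒜 (γ + γ') (MulOpposite.op r • n) :=
  Cofree.op_smul_single 𝒜 N hr γ n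

variable {𝒜} in
lemma cofree_addHom_ext {N : Type*} [AddCommGroup N] [Module Rᵐᵒᵖ N] {P : Type*} [AddCommMonoid P]
    {f g : (cofreeObj 𝒜 N).carrier →+ P} (h : ∀ γ n, f (inc 𝒜 γ n) = g (inc 𝒜 γ n)) : f = g :=
  Cofree.hom_ext h

variable {𝒜} in
lemma cofree_linear_ext {N : Type*} [AddCommGroup N] [Module Rᵐᵒᵖ N] {P : Type*} [AddCommGroup P]
    [Module Rᵐᵒᵖ P] {f g : (cofreeObj 𝒜 N).carrier →ₗ[Rᵐᵒᵖ] P}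
    (h : ∀ γ n, f (inc 𝒜 γ n) = g (inc 𝒜 γ n)) : f = g :=
  LinearMap.toAddMonoidHom_injective (cofree_addHom_ext h)

variable {𝒜} in
lemma cofree_hom_ext {N : Type w} [AddCommGroup N] [Module Rᵐᵒᵖ N] {M : GrModCat 𝒜}
    {f g : cofreeObj 𝒜 N ⟶ M} (h : ∀ γ n, lin f (inc 𝒜 γ n) = lin g (inc 𝒜 γ n)) : f = g :=
  Hom.ext (cofree_linear_ext h)

variable {𝒜} in
/-- The linear map out of a cofree graded module with prescribed restrictions to the components. -/
noncomputable def cofreeLift {N : Type*} [AddCommGroup N] [Module Rᵐᵒᵖ N] {P : Type*}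
    [AddCommGroup P] [Module Rᵐᵒᵖ P] (f : Γ → N →+ P)
    (h : ∀ γ γ', ∀ r ∈ 𝒜 γ', ∀ n, f (γ + γ') (MulOpposite.op r • n) = MulOpposite.op r • f γ n) :
    (cofreeObj 𝒜 N).carrier →ₗ[Rᵐᵒᵖ] P :=
  let F : (cofreeObj 𝒜 N).carrier →+ P := Cofree.lift f
  have hF (γ : Γ) (n : N) : F (inc 𝒜 γ n) = f γ n := Cofree.lift_single 𝒜 f γ n
  linearOfHomogeneous 𝒜 F fun γ' r hr x => by
    refine DFunLike.congr_fun (f := F.comp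
      (DistribSMul.toAddMonoidHom (cofreeObj 𝒜 N).carrier (MulOpposite.op r)))
      (g := (DistribSMul.toAddMonoidHom P (MulOpposite.op r)).comp F) ?_ x
    refine cofree_addHom_ext fun γ n => ?_
    change F (MulOpposite.op r • inc 𝒜 γ n) = MulOpposite.op r • F (inc 𝒜 γ n)
    rw [op_smul_inc 𝒜 hr, hF, hF, h γ γ' r hr n]

@[simp] lemma cofreeLift_inc {N : Type*} [AddCommGroup N] [Module Rᵐᵒᵖ N] {P : Type*}
    [AddCommGroup P] [Module Rᵐᵒᵖ P] (f : Γ → N →+ P)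
    (h : ∀ γ γ', ∀ r ∈ 𝒜 γ', ∀ n, f (γ + γ') (MulOpposite.op r • n) = MulOpposite.op r • f γ n)
    (γ : Γ) (n : N) : cofreeLift f h (inc 𝒜 γ n) = f γ n :=
  Cofree.lift_single 𝒜 f γ n

variable {𝒜} in
/-- The morphism of graded modules out of a cofree graded module with prescribed restrictions to
the components. -/
noncomputable def cofreeDesc {N : Type w} [AddCommGroup N] [Module Rᵐᵒᵖ N] {M : GrModCat 𝒜}
    (f : Γ → N →+ M.carrier) (hf : ∀ γ n, f γ n ∈ M.grading γ)
    (h : ∀ γ γ', ∀ r ∈ 𝒜 γ', ∀ n, f (γ + γ') (MulOpposite.op r • n) = MulOpposite.op r • f γ n) :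
    cofreeObj 𝒜 N ⟶ M :=
  ofLin (cofreeLift f h) (by
    rintro γ _ ⟨n, rfl⟩
    exact (cofreeLift_inc 𝒜 f h γ n).symm ▸ hf γ n)

@[simp] lemma lin_cofreeDesc_inc {N : Type w} [AddCommGroup N] [Module Rᵐᵒᵖ N] {M : GrModCat 𝒜}
    (f : Γ → N →+ M.carrier) (hf : ∀ γ n, f γ n ∈ M.grading γ)
    (h : ∀ γ γ', ∀ r ∈ 𝒜 γ', ∀ n, f (γ + γ') (MulOpposite.op r • n) = MulOpposite.op r • f γ n)
    (γ : Γ) (n : N) : lin (cofreeDesc f hf h) (inc 𝒜 γ n) = f γ n :=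
  cofreeLift_inc 𝒜 f h γ n

end GrModCat

/-! ### The adjunction with the forgetful functor -/

namespace GrModCat

section

variable {Γ : Type v} [AddCommGroup Γ] [DecidableEq Γ] {R : Type u} [Ring R]
  (𝒜 : Γ → AddSubgroup R)

/-- The functor that forgets the grading. -/
@[simps]
def forgetGrading : GrModCat.{w} 𝒜 ⥤ ModuleCat.{w} Rᵐᵒᵖ where
  obj M := ModuleCat.of Rᵐᵒᵖ M.carrier
  map f := ModuleCat.ofHom (lin f)

instance : (forgetGrading 𝒜).Additive where
  map_add := rfl

instance : (forgetGrading 𝒜).Faithful where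
  map_injective h := hom_ext fun m => congrArg (fun k => k.hom m) h

instance : (forgetGrading 𝒜).PreservesMonomorphisms where
  preserves f _ := (ModuleCat.mono_iff_injective _).2 (injective_of_mono f)

variable {𝒜} in
lemma hom_ext_of_homogeneous {M N : GrModCat.{w} 𝒜} {f g : M ⟶ N}
    (h : ∀ γ, ∀ m ∈ M.grading γ, lin f m = lin g m) : f = g :=
  Hom.ext (LinearMap.toAddMonoidHom_injective (addHom_ext h))

lemma epi_of_surjective {M N : GrModCat.{w} 𝒜} (f : M ⟶ N) (hf : Function.Surjective (lin f)) :
    Epi f :=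
  (forgetGrading 𝒜).epi_of_epi_map ((ModuleCat.epi_iff_surjective _).2 hf)

end

variable {Γ : Type u} [AddCommGroup Γ] [DecidableEq Γ] {R : Type u} [Ring R]
  (𝒜 : Γ → AddSubgroup R) [GradedRing 𝒜]

section

variable {N P : Type u} [AddCommGroup N] [AddCommGroup P] [Module Rᵐᵒᵖ N] [Module Rᵐᵒᵖ P]

/-- The morphism between cofree graded modules induced by a linear map. -/
noncomputable def cofreeMap (f : N →ₗ[Rᵐᵒᵖ] P) : cofreeObj 𝒜 N ⟶ cofreeObj 𝒜 P :=
  cofreeDesc (fun γ => (inc 𝒜 γ).comp f.toAddMonoidHom) (fun γ n => inc_mem 𝒜 γ _)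
    fun γ γ' r hr n => by simp [op_smul_inc 𝒜 hr]

@[simp] lemma lin_cofreeMap_inc (f : N →ₗ[Rᵐᵒᵖ] P) (γ : Γ) (n : N) :
    lin (cofreeMap 𝒜 f) (inc 𝒜 γ n) = inc 𝒜 γ (f n) :=
  lin_cofreeDesc_inc 𝒜 (fun γ => (inc 𝒜 γ).comp f.toAddMonoidHom) _ _ γ n

lemma lin_cofreeMap_surjective {f : N →ₗ[Rᵐᵒᵖ] P} (hf : Function.Surjective f) :
    Function.Surjective (lin (cofreeMap 𝒜 f)) := fun x => by
  obtain ⟨s, hx⟩ : ∃ s : Finset Γ, x = ∑ γ ∈ s, inc 𝒜 γ (Cofree.component 𝒜 γ x) :=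
    Cofree.sum_single_component 𝒜 x
  choose n hn using fun γ => hf (Cofree.component 𝒜 γ x)
  refine ⟨∑ γ ∈ s, inc 𝒜 γ (n γ), ?_⟩
  rw [map_sum, hx]
  exact Finset.sum_congr rfl fun γ _ => by rw [lin_cofreeMap_inc, hn]

variable (N) in
/-- The linear map `⨁ γ, N → N` that is the identity on every copy of `N`. -/
noncomputable def counitApp : (cofreeObj 𝒜 N).carrier →ₗ[Rᵐᵒᵖ] N :=
  cofreeLift (fun _ => AddMonoidHom.id N) fun _ _ _ _ _ => rfl

@[simp] lemma counitApp_inc (γ : Γ) (n : N) : counitApp 𝒜 N (inc 𝒜 γ n) = n :=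
  cofreeLift_inc 𝒜 (fun _ => AddMonoidHom.id N) _ γ n

end

variable {𝒜}

/-- The unit `M ⟶ ⨁ γ, M`, which maps a homogeneous element of degree `γ` to the copy of
index `γ`. -/
noncomputable def unitApp (M : GrModCat.{u} 𝒜) : M ⟶ cofreeObj 𝒜 M.carrier :=
  let F : M.carrier →+ (cofreeObj 𝒜 M.carrier).carrier := M.addHomOfComponents fun γ => inc 𝒜 γ
  have hF {γ : Γ} {m : M.carrier} (hm : m ∈ M.grading γ) : F m = inc 𝒜 γ m :=
    M.addHomOfComponents_of_mem _ hm
  ofLin (linearOfHomogeneous 𝒜 F fun γ' r hr m => by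
      refine DFunLike.congr_fun (f := F.comp
        (DistribSMul.toAddMonoidHom M.carrier (MulOpposite.op r)))
        (g := (DistribSMul.toAddMonoidHom _ (MulOpposite.op r)).comp F) ?_ m
      refine addHom_ext fun γ m hm => ?_
      change F (MulOpposite.op r • m) = MulOpposite.op r • F m
      rw [hF hm, hF (M.smul_mem hm hr), op_smul_inc 𝒜 hr])
    fun γ m hm => (hF hm).symm ▸ inc_mem 𝒜 γ m

lemma lin_unitApp_of_mem {M : GrModCat.{u} 𝒜} {γ : Γ} {m : M.carrier} (hm : m ∈ M.grading γ) :
    lin (unitApp M) m = inc 𝒜 γ m :=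
  M.addHomOfComponents_of_mem _ hm

/-- The retraction `⨁ γ, M ⟶ M` of the unit, which projects the copy of index `γ` to the component
of degree `γ`. -/
noncomputable def retractionApp (M : GrModCat.{u} 𝒜) : cofreeObj 𝒜 M.carrier ⟶ M :=
  cofreeDesc (fun γ => M.proj γ) (fun γ m => M.proj_mem γ m)
    fun γ _ _ hr m => M.proj_op_smul hr γ m

@[simp] lemma lin_retractionApp_inc (M : GrModCat.{u} 𝒜) (γ : Γ) (m : M.carrier) :
    lin (retractionApp M) (inc 𝒜 γ m) = M.proj γ m :=
  lin_cofreeDesc_inc 𝒜 (fun γ => M.proj γ) _ _ γ m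

variable (𝒜)

/-- The functor that sends a module to the cofree graded module on it. -/
noncomputable def cofree : ModuleCat.{u} Rᵐᵒᵖ ⥤ GrModCat.{u} 𝒜 where
  obj N := cofreeObj 𝒜 N
  map f := cofreeMap 𝒜 f.hom
  map_id N := cofree_hom_ext fun γ n => by simp
  map_comp f g := cofree_hom_ext fun γ n => by simp

instance : (cofree 𝒜).Additive where
  map_add {N P f g} := cofree_hom_ext (f := cofreeMap 𝒜 (f + g).hom)
    (g := cofreeMap 𝒜 f.hom + cofreeMap 𝒜 g.hom) fun γ n => by simp

instance : (cofree 𝒜).PreservesEpimorphisms where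
  preserves f _ := epi_of_surjective 𝒜 _
    (lin_cofreeMap_surjective 𝒜 ((ModuleCat.epi_iff_surjective f).1 inferInstance))

/-- The forgetful functor is left adjoint to the cofree functor. -/
noncomputable def forgetCofreeAdjunction : forgetGrading 𝒜 ⊣ cofree 𝒜 :=
  Adjunction.mkOfUnitCounit
    { unit :=
        { app := unitApp
          naturality := fun M N f => hom_ext_of_homogeneous
            (f := f ≫ unitApp N) (g := unitApp M ≫ cofreeMap 𝒜 (lin f)) fun γ m hm => by
              simp [lin_unitApp_of_mem hm, lin_unitApp_of_mem (lin_mem f hm)] }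
      counit :=
        { app := fun N => ModuleCat.ofHom (counitApp 𝒜 N)
          naturality := fun N P f => ModuleCat.hom_ext <| cofree_linear_ext
            (f := counitApp 𝒜 P ∘ₗ lin (cofreeMap 𝒜 f.hom)) (g := f.hom ∘ₗ counitApp 𝒜 N)
            fun γ n => by simp }
      left_triangle := by
        refine NatTrans.ext (funext fun M => ModuleCat.hom_ext ?_)
        refine LinearMap.toAddMonoidHom_injective (addHom_ext (M := M)
          (f := (counitApp 𝒜 M.carrier ∘ₗ lin (unitApp M)).toAddMonoidHom)
          (g := AddMonoidHom.id _) fun γ m hm => ?_)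
        simp [lin_unitApp_of_mem hm]
      right_triangle := by
        refine NatTrans.ext (funext fun N => cofree_hom_ext
          (f := unitApp (cofreeObj 𝒜 N) ≫ cofreeMap 𝒜 (counitApp 𝒜 N)) (g := 𝟙 _) fun γ n => ?_)
        simp [lin_unitApp_of_mem (inc_mem 𝒜 γ n)] }

/-- Every graded module is a natural retract of a cofree one. -/
noncomputable def retraction : forgetGrading 𝒜 ⋙ cofree 𝒜 ⟶ 𝟭 (GrModCat.{u} 𝒜) where
  app := retractionApp
  naturality M N f := cofree_hom_ext (f := cofreeMap 𝒜 (lin f) ≫ retractionApp N)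
    (g := retractionApp M ≫ f) fun γ m => by simp [lin_proj]

lemma unit_comp_retraction : (forgetCofreeAdjunction 𝒜).unit ≫ retraction 𝒜 = 𝟙 _ :=
  NatTrans.ext (funext fun M => hom_ext_of_homogeneous
    (f := unitApp M ≫ retractionApp M) (g := 𝟙 M) fun γ m hm => by
      simp [lin_unitApp_of_mem hm, M.proj_same hm])

/-! ### Exactness of the forgetful and the cofree functor -/

instance : (forgetGrading.{u} 𝒜).IsLeftAdjoint := (forgetCofreeAdjunction 𝒜).isLeftAdjoint

instance : (cofree 𝒜).IsRightAdjoint := (forgetCofreeAdjunction 𝒜).isRightAdjoint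

instance : PreservesFiniteLimits (forgetGrading.{u} 𝒜) :=
  have := (forgetGrading.{u} 𝒜).preservesHomology_of_preservesMonos_and_cokernels
  (forgetGrading.{u} 𝒜).preservesFiniteLimits_of_preservesHomology

instance : PreservesFiniteColimits (cofree 𝒜) :=
  have := (cofree 𝒜).preservesHomology_of_preservesEpis_and_kernels
  (cofree 𝒜).preservesFiniteColimits_of_preservesHomology

instance : (cofree 𝒜).PreservesInjectiveObjects where
  injective_obj {I} hI := (forgetCofreeAdjunction 𝒜).map_injective I hI

/-! ### Coproducts of graded modules -/

/-- The forgetful functor is comonadic, so it creates colimits. -/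
instance hasCoproductsOfShape (J : Type u) : HasColimitsOfShape (Discrete J) (GrModCat.{u} 𝒜) := by
  have : Comonad.PreservesLimitOfIsCoreflexivePair (forgetGrading.{u} 𝒜) :=
    ⟨fun _ _ _ _ _ => inferInstance⟩
  let := Comonad.comonadicOfHasPreservesCoreflexiveEqualizersOfReflectsIsomorphisms
    (forgetCofreeAdjunction 𝒜)
  let := comonadicCreatesColimits.{u, u} (forgetGrading.{u} 𝒜)
  exact hasColimitsOfShape_of_hasColimitsOfShape_createsColimitsOfShape (forgetGrading.{u} 𝒜)

instance : AB4 (GrModCat.{u} 𝒜) where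
  ofShape J := HasExactColimitsOfShape.domain_of_functor (Discrete J) (forgetGrading.{u} 𝒜)

/-- A morphism out of the cofree graded module on a colimit amounts to a family of additive maps out
of the colimit, one for each degree, because the forgetful functor from modules to abelian groups
preserves colimits. -/
instance preservesColimitsOfShape_cofree (J : Type u) [Category.{u} J] :
    PreservesColimitsOfShape J (cofree 𝒜) where
  preservesColimit {K} := ⟨fun {t} ht => ⟨IsColimit.ofExistsUnique fun s => by
    let ht' := isColimitOfPreserves (forget₂ (ModuleCat.{u} Rᵐᵒᵖ) AddCommGrpCat.{u}) ht
    have ext {P : Type u} [AddCommGroup P] {f g : t.pt →+ P}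
        (h : ∀ j n, f (t.ι.app j n) = g (t.ι.app j n)) : f = g := by
      have := ht'.hom_ext (f := AddCommGrpCat.ofHom f) (f' := AddCommGrpCat.ofHom g)
        fun j => AddCommGrpCat.hom_ext (AddMonoidHom.ext (h j))
      exact congrArg AddCommGrpCat.Hom.hom this
    let σ (j : J) : cofreeObj 𝒜 (K.obj j) ⟶ s.pt := s.ι.app j
    have hσ {j j' : J} (f : j ⟶ j') : cofreeMap 𝒜 (K.map f).hom ≫ σ j' = σ j :=
      s.w f
    obtain ⟨D, hD⟩ : ∃ D : Γ → t.pt →+ s.pt.carrier,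
        ∀ γ j n, D γ (t.ι.app j n) = lin (σ j) (inc 𝒜 γ n) := by
      let τ (γ : Γ) (j : J) : K.obj j →+ s.pt.carrier :=
        (lin (σ j)).toAddMonoidHom.comp (inc 𝒜 γ)
      let c (γ : Γ) : Cocone (K ⋙ forget₂ (ModuleCat.{u} Rᵐᵒᵖ) AddCommGrpCat.{u}) :=
        { pt := AddCommGrpCat.of s.pt.carrier
          ι :=
            { app := fun j => AddCommGrpCat.ofHom (τ γ j)
              naturality := fun j j' f => AddCommGrpCat.hom_ext (AddMonoidHom.ext fun (n : K.obj j) => by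
                have := congrArg (fun k => lin k (inc 𝒜 γ n)) (hσ f)
                rwa [lin_comp, lin_cofreeMap_inc] at this) } }
      exact ⟨fun γ => (ht'.desc (c γ)).hom, fun γ j n =>
        congrArg (fun k => k.hom n) (ht'.fac (c γ) j)⟩
    have hmem (γ : Γ) (n : t.pt) : D γ n ∈ s.pt.grading γ := by
      have : (s.pt.proj γ).comp (D γ) = D γ := ext fun j n => by
        rw [AddMonoidHom.comp_apply, hD, s.pt.proj_same (lin_mem _ (inc_mem 𝒜 γ n))]
      rw [← this]
      exact s.pt.proj_mem γ _
    have hsmul (γ γ' : Γ) (r : R) (hr : r ∈ 𝒜 γ') (n : t.pt) :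
        D (γ + γ') (MulOpposite.op r • n) = MulOpposite.op r • D γ n := by
      refine DFunLike.congr_fun (f := (D (γ + γ')).comp
        (DistribSMul.toAddMonoidHom t.pt (MulOpposite.op r)))
        (g := (DistribSMul.toAddMonoidHom s.pt.carrier (MulOpposite.op r)).comp (D γ))
        (ext fun j n => ?_) n
      change D (γ + γ') (MulOpposite.op r • t.ι.app j n) = MulOpposite.op r • D γ (t.ι.app j n)
      rw [← map_smul (t.ι.app j).hom, hD, hD, ← map_smul, op_smul_inc 𝒜 hr]
    refine ⟨cofreeDesc D hmem hsmul, fun j => ?_,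
      fun (d : cofreeObj 𝒜 t.pt ⟶ s.pt) hd => ?_⟩
    · exact cofree_hom_ext (f := cofreeMap 𝒜 (t.ι.app j).hom ≫ cofreeDesc D hmem hsmul) (g := σ j)
        fun γ n => by
          rw [lin_comp, lin_cofreeMap_inc, lin_cofreeDesc_inc]
          exact hD γ j n
    · refine cofree_hom_ext fun γ n => ?_
      rw [lin_cofreeDesc_inc]
      refine DFunLike.congr_fun (f := (lin d).toAddMonoidHom.comp (inc 𝒜 γ))
        (ext fun j n => ?_) n
      have := congrArg (fun k => lin k (inc 𝒜 γ n))
        (show cofreeMap 𝒜 (t.ι.app j).hom ≫ d = σ j from hd j)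
      rw [lin_comp, lin_cofreeMap_inc] at this
      exact this.trans (hD γ j n).symm⟩⟩

end GrModCat

theorem mainTheorem7 {Γ : Type u} [AddCommGroup Γ] [DecidableEq Γ] {R : Type u} [Ring R]
    (𝒜 : Γ → AddSubgroup R) [GradedRing 𝒜]
    [HasDerivedCategory.{w} (ModuleCat.{u} Rᵐᵒᵖ)] [HasDerivedCategory.{w'} (GrModCat.{u} 𝒜)]
    (h : InjGen.RingInjectivesGenerate R) : InjGen.GradedInjectivesGenerate 𝒜 :=
  InjGen.InjectivesGenerate.of_retract (GrModCat.cofree 𝒜) (GrModCat.forgetGrading.{u} 𝒜) _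
    (GrModCat.retraction 𝒜) (GrModCat.unit_comp_retraction 𝒜) h
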